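/- **Theorem (Stability of En-BlendedBDF).** Let $d\in\{2,3\}$ and let $\Omega\subset\mathbb R^d$ be open and bounded. Let $\|\cdot\|$ and $(\cdot,\cdot)$ be the norm and inner product of $L^2(\Omega)$ (for scalars, vectors and, with the Frobenius norm, tensors), $X=H_0^1(\Omega)^d$ the closure of $C_c^\infty(\Omega)^d$ in the $H^1$ norm, $Q=L^2_0(\Omega)$ the space of $L^2$ functions of mean zero, and, for $u,v,w\in X$ and $f\in X'$ (with $(f,v)$ the duality pairing, equal to the $L^2$ inner product if $f\in L^2(\Omega)^d$), $$b^*(u,v,w)=\tfrac12(u\cdot\nabla v,w)-\tfrac12(u\cdot\nabla w,v),\qquad \|f\|_{-1}=\sup_{0\ne v\in X}\frac{(f,v)}{\|\nabla v\|}.$$ For every $C_{\rm inv}>0$ there is a constant $C>0$, depending only on $d$, $\Omega$ and $C_{\rm inv}$, with the following property. Let $h>0$, and let $X_h\subset X$, $Q_h\subset Q$ be finite-dimensional subspaces (for instance conforming finite element spaces on a mesh of maximal element diameter $h$) such that the inverse inequality $h\|\nabla v_h\|\le C_{\rm inv}\|v_h\|$ holds for all $v_h\in X_h$. Let $\nu>0$,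 $\Delta t>0$, let $J\ge 1$ and $N_T$ be integers, and let $f_j^{n}\in X'$ for $1\le j\le J$ and $n\le N_T$. Let $u_{j,h}^n\in X_h$ $(0\le n\le N_T)$ and $p_{j,h}^{n}\in Q_h$ $(3\le n\le N_T)$, $j=1,\dots,J$, be such that for all $j$ and all $2\le n\le N_T-1$ $$\Big(\frac{10u_{j,h}^{n+1}-15u_{j,h}^{n}+6u_{j,h}^{n-1}-u_{j,h}^{n-2}}{6\Delta t},v_h\Big)+b^*\big(\langle u_h\rangle^n,u_{j,h}^{n+1},v_h\big)+b^*\big(u_{j,h}'^{\,n},3u_{j,h}^n-3u_{j,h}^{n-1}+u_{j,h}^{n-2},v_h\big)$$ $$-(p_{j,h}^{n+1},\nabla\cdot v_h)+\nu(\nabla u_{j,h}^{n+1},\nabla v_h)=(f_j^{n+1},v_h)\quad\forall v_h\in X_h,\qquad (\nabla\cdot u_{j,h}^{n+1},q_h)=0\quad\forall q_h\in Q_h,$$ where $$\langle u_h\rangle^n=\frac1J\sum_{j=1}^J\big(3u_{j,h}^n-3u_{j,h}^{n-1}+u_{j,h}^{n-2}\big),\qquad u_{j,h}'^{\,n}=3u_{j,h}^n-3u_{j,h}^{n-1}+u_{j,h}^{n-2}-\langle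 u_h\rangle^n .$$ Suppose that $$C\,\frac{\Delta t}{\nu h}\,\|\nabla u_{j,h}'^{\,n}\|^2\le 1\qquad\text{for } j=1,\dots,J,\ 2\le n\le N_T-1 .$$ Then for every $j$ and every integer $N$ with $2<N\le N_T$ $$\tfrac1{12}\|u_{j,h}^N\|^2+\tfrac1{12}\|3u_{j,h}^N-u_{j,h}^{N-1}\|^2+\tfrac1{12}\|3u_{j,h}^N-3u_{j,h}^{N-1}+u_{j,h}^{N-2}\|^2$$ $$+\tfrac1{24}\sum_{n=2}^{N-1}\|u_{j,h}^{n+1}-3u_{j,h}^n+3u_{j,h}^{n-1}-u_{j,h}^{n-2}\|^2+\tfrac{\Delta t}{4}\sum_{n=2}^{N-1}\nu\|\nabla u_{j,h}^{n+1}\|^2$$ $$\le\sum_{n=2}^{N-1}\frac{\Delta t}{\nu}\|f_j^{n+1}\|_{-1}^2+\tfrac1{12}\|u_{j,h}^2\|^2+\tfrac1{12}\|3u_{j,h}^2-u_{j,h}^1\|^2+\tfrac1{12}\|3u_{j,h}^2-3u_{j,h}^1+u_{j,h}^0\|^2 .$$ -/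

import Mathlib

open MeasureTheory
open scoped ContDiff

noncomputable section

namespace EnBlended

/-- Points of `ℝ^d`, and vector values, with the Euclidean norm. -/
abbrev Vec (d : ℕ) := EuclideanSpace ℝ (Fin d)

/-- `d × d` tensors with the Frobenius norm; the entry `(i, k)` of a velocity gradient is
`∂ₖ vᵢ`. -/
abbrev Tens (d : ℕ) := EuclideanSpace ℝ (Fin d × Fin d)

/-- `L²(Ω; F)`, with its usual norm and inner product. -/
abbrev L2 {d : ℕ} (Ω : Set (Vec d)) (F : Type*) [NormedAddCommGroup F] :=
  Lp F 2 (volume.restrict Ω)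

/-- The classical gradient of a vector field, as a tensor. -/
def jacobian {d : ℕ} (φ : Vec d → Vec d) (x : Vec d) : Tens d :=
  WithLp.toLp 2 fun ik => fderiv ℝ φ x (EuclideanSpace.single ik.2 1) ik.1

/-- The pairs `(φ, ∇φ)` in `L²(Ω)^d × L²(Ω)^{d×d}` for `φ ∈ C_c^∞(Ω)^d`. -/
def testPairs {d : ℕ} (Ω : Set (Vec d)) : Submodule ℝ (L2 Ω (Vec d) × L2 Ω (Tens d)) where
  carrier := {P | ∃ φ : Vec d → Vec d, ContDiff ℝ ∞ φ ∧ HasCompactSupport φ ∧ tsupport φ ⊆ Ω ∧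
    P.1 =ᵐ[volume.restrict Ω] φ ∧ P.2 =ᵐ[volume.restrict Ω] jacobian φ}
  zero_mem' := by
    refine ⟨0, contDiff_const, HasCompactSupport.zero, by simp [tsupport],
      Lp.coeFn_zero _ _ _, ?_⟩
    filter_upwards [Lp.coeFn_zero (Tens d) 2 (volume.restrict Ω)] with x hx
    rw [Prod.snd_zero, hx]
    ext ik
    simp [jacobian]
  add_mem' := by
    rintro P P' ⟨φ, h1, h2, h3, h4, h5⟩ ⟨ψ, k1, k2, k3, k4, k5⟩
    refine ⟨φ + ψ, h1.add k1, h2.add k2,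
      (tsupport_add φ ψ).trans (Set.union_subset h3 k3), ?_, ?_⟩
    · exact (Lp.coeFn_add _ _).trans (h4.add k4)
    · refine (Lp.coeFn_add _ _).trans ((h5.add k5).trans (Filter.Eventually.of_forall ?_))
      intro x
      ext ik
      have a := (h1.differentiable (by simp)) x
      have b := (k1.differentiable (by simp)) x
      simp [jacobian, fderiv_add a b]
  smul_mem' := by
    rintro c P ⟨φ, h1, h2, h3, h4, h5⟩
    refine ⟨c • φ, contDiff_const.smul h1, h2.smul_left (f := fun _ => c),
      (tsupport_smul_subset_right (fun _ => c) φ).trans h3, ?_, ?_⟩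
    · exact (Lp.coeFn_smul _ _).trans (h4.const_smul c)
    · refine (Lp.coeFn_smul _ _).trans
        ((h5.const_smul c).trans (Filter.Eventually.of_forall ?_))
      intro x
      ext ik
      have a := (h1.differentiable (by simp)) x
      simp [jacobian, fderiv_const_smul a]

/-- The velocity space `X = H¹₀(Ω)^d`: the closure of `C_c^∞(Ω)^d` in the `H¹` norm. An element
is stored as the pair `(v, ∇v)` of an `L²` field and its weak gradient. -/
def H10 {d : ℕ} (Ω : Set (Vec d)) : Submodule ℝ (L2 Ω (Vec d) × L2 Ω (Tens d)) :=
  (testPairs Ω).topologicalClosure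

/-- The `L²` field underlying an element of `X`. -/
def vel {d : ℕ} {Ω : Set (Vec d)} (v : H10 Ω) : L2 Ω (Vec d) := v.1.1

/-- The gradient `∇v ∈ L²(Ω)^{d×d}`. -/
def grad {d : ℕ} {Ω : Set (Vec d)} (v : H10 Ω) : L2 Ω (Tens d) := v.1.2

theorem pairing_continuous {d : ℕ} {ι : Type} [Fintype ι] (Ω : Set (Vec d)) (i : ι)
    {g : Vec d → ℝ} (hg : MemLp g 2 (volume.restrict Ω)) :
    Continuous fun P : L2 Ω (EuclideanSpace ℝ ι) => ∫ x in Ω, P x i * g x := by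
  have h : (fun P : L2 Ω (EuclideanSpace ℝ ι) => ∫ x in Ω, P x i * g x) =
      fun P => inner ℝ (hg.toLp g)
        ((EuclideanSpace.proj i : EuclideanSpace ℝ ι →L[ℝ] ℝ).compLp P) := by
    funext P
    rw [L2.inner_def]
    refine integral_congr_ae ?_
    filter_upwards [hg.coeFn_toLp,
      (EuclideanSpace.proj i : EuclideanSpace ℝ ι →L[ℝ] ℝ).coeFn_compLp P] with x h1 h2
    rw [h1, h2]
    simp
  rw [h]
  exact continuous_const.inner
    ((EuclideanSpace.proj i : EuclideanSpace ℝ ι →L[ℝ] ℝ).compLpL 2 (volume.restrict Ω)).continuous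

/-- The second component of an element of `X` is the weak gradient of the first. -/
theorem weak_grad {d : ℕ} {Ω : Set (Vec d)} (v : H10 Ω) {ψ : Vec d → ℝ} (hψ : ContDiff ℝ ∞ ψ)
    (hc : HasCompactSupport ψ) (i k : Fin d) :
    ∫ x in Ω, vel v x i * fderiv ℝ ψ x (EuclideanSpace.single k 1) =
      -∫ x in Ω, grad v x (i, k) * ψ x := by
  have hd : Continuous fun x => fderiv ℝ ψ x (EuclideanSpace.single k 1) :=
    (hψ.continuous_fderiv (by simp)).clm_apply continuous_const
  have hdc : HasCompactSupport fun x => fderiv ℝ ψ x (EuclideanSpace.single k 1) :=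
    hc.fderiv_apply (𝕜 := ℝ) _
  have m1 : MemLp ψ 2 (volume.restrict Ω) := (hψ.continuous.memLp_of_hasCompactSupport hc)
  have m2 : MemLp (fun x => fderiv ℝ ψ x (EuclideanSpace.single k 1)) 2 (volume.restrict Ω) :=
    hd.memLp_of_hasCompactSupport hdc
  have c1 := (pairing_continuous Ω i m2).comp
    (continuous_fst : Continuous (Prod.fst : L2 Ω (Vec d) × L2 Ω (Tens d) → _))
  have c2 := ((pairing_continuous Ω (i, k) m1).comp
    (continuous_snd : Continuous (Prod.snd : L2 Ω (Vec d) × L2 Ω (Tens d) → _))).neg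
  have hv : v.1 ∈ closure (testPairs Ω : Set (L2 Ω (Vec d) × L2 Ω (Tens d))) := v.2
  refine closure_minimal ?_ (isClosed_eq c1 c2) hv
  rintro P ⟨φ, h1, h2, h3, h4, h5⟩
  have e1 : ∫ x in Ω, P.1 x i * fderiv ℝ ψ x (EuclideanSpace.single k 1) =
      ∫ x, φ x i * fderiv ℝ ψ x (EuclideanSpace.single k 1) := by
    rw [integral_congr_ae (g := fun x => φ x i * fderiv ℝ ψ x (EuclideanSpace.single k 1))
      (by filter_upwards [h4] with x hx; rw [hx])]
    refine setIntegral_eq_integral_of_forall_compl_eq_zero fun x hx => ?_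
    rw [image_eq_zero_of_notMem_tsupport (fun h => hx (h3 h))]; simp
  have e2 : ∫ x in Ω, P.2 x (i, k) * ψ x =
      ∫ x, fderiv ℝ φ x (EuclideanSpace.single k 1) i * ψ x := by
    rw [integral_congr_ae (g := fun x => fderiv ℝ φ x (EuclideanSpace.single k 1) i * ψ x)
      (by filter_upwards [h5] with x hx; rw [hx]; rfl)]
    refine setIntegral_eq_integral_of_forall_compl_eq_zero fun x hx => ?_
    rw [fderiv_of_notMem_tsupport (𝕜 := ℝ) (fun h => hx (h3 h))]; simp
  show (∫ x in Ω, P.1 x i * fderiv ℝ ψ x (EuclideanSpace.single k 1)) =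
    -∫ x in Ω, P.2 x (i, k) * ψ x
  rw [e1, e2]
  have hφi : ContDiff ℝ ∞ fun x => φ x i :=
    (EuclideanSpace.proj i : Vec d →L[ℝ] ℝ).contDiff.comp h1
  have hf : ∀ x, fderiv ℝ (fun x => φ x i) x (EuclideanSpace.single k 1) =
      fderiv ℝ φ x (EuclideanSpace.single k 1) i := by
    intro x
    have := ((EuclideanSpace.proj i : Vec d →L[ℝ] ℝ).hasFDerivAt.comp x
      (h1.differentiable (by simp) x).hasFDerivAt).fderiv
    have e : (fun x => φ x i) = (EuclideanSpace.proj i : Vec d →L[ℝ] ℝ) ∘ φ := rfl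
    rw [e, this]; rfl
  simp_rw [← hf]
  have hfc : Continuous fun x => fderiv ℝ (fun x => φ x i) x (EuclideanSpace.single k 1) :=
    (hφi.continuous_fderiv (by simp)).clm_apply continuous_const
  refine integral_mul_fderiv_eq_neg_fderiv_mul_of_integrable ?_ ?_ ?_
    (fun x _ => hφi.differentiable (by simp) x) (fun x _ => hψ.differentiable (by simp) x)
  · exact (hfc.mul hψ.continuous).integrable_of_hasCompactSupport hc.mul_left
  · exact (hφi.continuous.mul hd).integrable_of_hasCompactSupport hdc.mul_left
  · exact (hφi.continuous.mul hψ.continuous).integrable_of_hasCompactSupport hc.mul_left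

/-- The divergence `∇·v ∈ L²(Ω)`, the trace of `∇v`. -/
def div {d : ℕ} {Ω : Set (Vec d)} (v : H10 Ω) : L2 Ω ℝ :=
  (∑ i : Fin d, (EuclideanSpace.proj (i, i) : Tens d →L[ℝ] ℝ)).compLp (grad v)

/-- The pressure space `Q = L²₀(Ω)` of square integrable functions of zero mean. -/
def L20 {d : ℕ} (Ω : Set (Vec d)) : Set (L2 Ω ℝ) := {q | ∫ x in Ω, q x = 0}

/-- `(u·∇v, w) = ∫_Ω ∑ᵢ ∑ₖ uₖ (∂ₖ vᵢ) wᵢ`. -/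
def convect {d : ℕ} {Ω : Set (Vec d)} (u v w : H10 Ω) : ℝ :=
  ∫ x in Ω, ∑ i, ∑ k, vel u x k * grad v x (i, k) * vel w x i

/-- The skew-symmetric trilinear form `b*(u, v, w)`. -/
def bStar {d : ℕ} {Ω : Set (Vec d)} (u v w : H10 Ω) : ℝ :=
  1 / 2 * convect u v w - 1 / 2 * convect u w v

/-- The dual norm `‖f‖₋₁ = sup_{0 ≠ v ∈ X} (f, v) / ‖∇v‖`. -/
def negNorm {d : ℕ} {Ω : Set (Vec d)} (f : H10 Ω →L[ℝ] ℝ) : ℝ :=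
  ⨆ v : {v : H10 Ω // v ≠ 0}, f v.1 / ‖grad v.1‖

/-- The extrapolation `3wⁿ - 3wⁿ⁻¹ + wⁿ⁻²` (used for `n ≥ 2` only). -/
def extrap {d : ℕ} {Ω : Set (Vec d)} (w : ℕ → H10 Ω) (n : ℕ) : H10 Ω :=
  (3 : ℝ) • w n - (3 : ℝ) • w (n - 1) + w (n - 2)

/-- The ensemble mean `⟨u⟩ⁿ`. -/
def mean {d J : ℕ} {Ω : Set (Vec d)} (u : Fin J → ℕ → H10 Ω) (n : ℕ) : H10 Ω :=
  (1 / (J : ℝ)) • ∑ j, extrap (u j) n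

/-- The fluctuation `u'ⱼⁿ`. -/
def fluct {d J : ℕ} {Ω : Set (Vec d)} (u : Fin J → ℕ → H10 Ω) (j : Fin J) (n : ℕ) : H10 Ω :=
  extrap (u j) n - mean u n

/-- The blended difference quotient `(10wⁿ⁺¹ - 15wⁿ + 6wⁿ⁻¹ - wⁿ⁻²) / (6Δt)` (for `n ≥ 2`). -/
def blendedBDF {d : ℕ} {Ω : Set (Vec d)} (Δt : ℝ) (w : ℕ → H10 Ω) (n : ℕ) : H10 Ω :=
  (1 / (6 * Δt)) •
    ((10 : ℝ) • w (n + 1) - (15 : ℝ) • w n + (6 : ℝ) • w (n - 1) - w (n - 2))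

/-- `u j n`, `p j n` are velocities and pressures produced by the fully discrete ensemble scheme
up to time level `NT`; the starting velocities `u j 0`, `u j 1`, `u j 2` are arbitrary in `Xh`. -/
structure IsSchemeSolution {d J : ℕ} {Ω : Set (Vec d)} (Xh : Submodule ℝ (H10 Ω))
    (Qh : Submodule ℝ (L2 Ω ℝ)) (ν Δt : ℝ) (f : Fin J → ℕ → (H10 Ω →L[ℝ] ℝ)) (NT : ℕ)
    (u : Fin J → ℕ → H10 Ω) (p : Fin J → ℕ → L2 Ω ℝ) : Prop where
  vel_mem : ∀ j n, n ≤ NT → u j n ∈ Xh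
  pres_mem : ∀ j n, 2 ≤ n → n < NT → p j (n + 1) ∈ Qh
  momentum : ∀ j n, 2 ≤ n → n < NT → ∀ v ∈ Xh,
    inner ℝ (vel (blendedBDF Δt (u j) n)) (vel v)
      + bStar (mean u n) (u j (n + 1)) v
      + bStar (fluct u j n) (extrap (u j) n) v
      - inner ℝ (p j (n + 1)) (div v)
      + ν * inner ℝ (grad (u j (n + 1))) (grad v)
    = f j (n + 1) v
  mass : ∀ j n, 2 ≤ n → n < NT → ∀ q ∈ Qh, inner ℝ (div (u j (n + 1))) q = 0

end EnBlended

end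

/-! The momentum equation is tested with `v = uⁿ⁺¹`. The mean convection term drops out by skew
symmetry, the pressure term by discrete incompressibility. The difference quotient is G-stable
(`inner_blended_eq`): `Δt` times its pairing with `uⁿ⁺¹` is the increment of `energy` plus
`‖w‖²/12`, where `w` is the third difference `uⁿ⁺¹ - 3uⁿ + 3uⁿ⁻¹ - uⁿ⁻²`.

The extrapolation equals `uⁿ⁺¹ - w`, so the fluctuation term is `-b*(u', w, uⁿ⁺¹)`, to be absorbed
by `‖w‖²/12` and the viscosity. This requires a bound costing only half a derivative of `w`.
Integration by parts (`tri_add_tri_add_tri_eq_zero`) takes the gradient off `w`; Hölder with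
exponents 6, 2, 3 and Sobolev's inequality, valid for `d ≤ 3`, then give `abs_bStar_le`. As `w` lies
in `Xh`, the inverse inequality turns `‖∇w‖^{1/2} ‖w‖^{1/2}` into a multiple of `h^{-1/2} ‖w‖`, and
Young's inequality leaves exactly the time step restriction (`mul_abs_bStar_le`). The forcing is
handled by duality and Young, and the one-step estimates telescope. -/

noncomputable section

namespace EnBlended

open Filter Topology
open scoped ENNReal NNReal

/-! ### Hölder, Sobolev and Poincaré inequalities -/

/-- Hölder's inequality with exponents `6`, `2` and `3`, the `L³` norm being interpolated between
`L²` and `L⁶`. -/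
theorem lintegral_mul_mul_le {α E F G : Type*} [MeasurableSpace α] {μ : Measure α}
    [NormedAddCommGroup E] [NormedAddCommGroup F] [NormedAddCommGroup G]
    {a : α → E} {b : α → F} {c : α → G} (ha : AEStronglyMeasurable a μ)
    (hb : AEStronglyMeasurable b μ) (hc : AEStronglyMeasurable c μ) :
    ∫⁻ x, ‖a x‖ₑ * ‖b x‖ₑ * ‖c x‖ₑ ∂μ ≤
      eLpNorm a 6 μ * eLpNorm b 2 μ * (eLpNorm c 6 μ ^ (1 / 2 : ℝ) * eLpNorm c 2 μ ^ (1 / 2 : ℝ)) := by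
  have key := ENNReal.lintegral_prod_norm_pow_le (μ := μ) (Finset.univ : Finset (Fin 4))
    (f := ![fun x => ‖a x‖ₑ ^ (6 : ℝ), fun x => ‖b x‖ₑ ^ (2 : ℝ), fun x => ‖c x‖ₑ ^ (6 : ℝ),
      fun x => ‖c x‖ₑ ^ (2 : ℝ)])
    (by
      intro i _
      fin_cases i
      · exact ha.enorm.pow_const _
      · exact hb.enorm.pow_const _
      · exact hc.enorm.pow_const _
      · exact hc.enorm.pow_const _)
    -- The weights sum to 1; the last two come from `|c| = (|c|⁶)^{1/12} (|c|²)^{1/4}`.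
    (p := ![1 / 6, 1 / 2, 1 / 12, 1 / 4])
    (by simp [Fin.sum_univ_four]; norm_num)
    (by intro i _; fin_cases i <;> norm_num)
  have e6 : ∀ {H : Type _} [NormedAddCommGroup H] (g : α → H),
      eLpNorm g 6 μ = (∫⁻ x, ‖g x‖ₑ ^ (6 : ℝ) ∂μ) ^ (1 / 6 : ℝ) := by
    intro H _ g
    rw [eLpNorm_eq_lintegral_rpow_enorm_toReal (by norm_num) (by norm_num)]
    norm_num
  have e2 : ∀ {H : Type _} [NormedAddCommGroup H] (g : α → H),
      eLpNorm g 2 μ = (∫⁻ x, ‖g x‖ₑ ^ (2 : ℝ) ∂μ) ^ (1 / 2 : ℝ) := by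
    intro H _ g
    rw [eLpNorm_eq_lintegral_rpow_enorm_toReal (by norm_num) (by norm_num)]
    norm_num
  rw [e6 a, e2 b, eLpNorm_eq_lintegral_rpow_enorm_toReal (f := c) (p := 6) (by norm_num) (by norm_num),
    eLpNorm_eq_lintegral_rpow_enorm_toReal (f := c) (p := 2) (by norm_num) (by norm_num)]
  simp only [Fin.prod_univ_four, Matrix.cons_val] at key
  simp only [← ENNReal.rpow_mul, ENNReal.toReal_ofNat] at key ⊢
  have hh : ∀ t : ℝ≥0∞, t = t ^ (1 / 2 : ℝ) * t ^ (1 / 2 : ℝ) := fun t => by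
    rw [← ENNReal.rpow_add_of_nonneg _ _ (by norm_num) (by norm_num)]; norm_num
  norm_num at key ⊢
  refine le_trans (le_of_eq (lintegral_congr fun x => ?_)) (key.trans (le_of_eq (by ring)))
  conv_lhs => rw [hh ‖c x‖ₑ]
  norm_num
  ring

/-- Cauchy–Schwarz in each row. This passes from the operator norm in Sobolev's inequality to the
Frobenius norm. -/
theorem norm_fderiv_le_norm_jacobian {d : ℕ} (φ : Vec d → Vec d) (x : Vec d) :
    ‖fderiv ℝ φ x‖ ≤ ‖jacobian φ x‖ := by
  refine ContinuousLinearMap.opNorm_le_bound _ (norm_nonneg _) fun y => ?_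
  have hy : ∀ i, fderiv ℝ φ x y i = ∑ k, jacobian φ x (i, k) * y k := by
    intro i
    have : y = ∑ k, y k • EuclideanSpace.single k (1 : ℝ) := by
      ext l; simp [Pi.single_apply]
    conv_lhs => rw [this]
    simp [jacobian, mul_comm]
  rw [EuclideanSpace.norm_eq, EuclideanSpace.norm_eq, EuclideanSpace.norm_eq,
    ← Real.sqrt_mul (Finset.sum_nonneg fun _ _ => sq_nonneg _)]
  refine Real.sqrt_le_sqrt ?_
  rw [Fintype.sum_prod_type, Finset.sum_mul]
  refine Finset.sum_le_sum fun i _ => ?_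
  simp only [Real.norm_eq_abs, sq_abs, hy]
  exact Finset.sum_mul_sq_le_sq_mul_sq _ _ _

/-- Sobolev's inequality for test fields. -/
theorem exists_eLpNorm_six_le {d : ℕ} (hd : d = 2 ∨ d = 3) {Ω : Set (Vec d)}
    (hΩb : Bornology.IsBounded Ω) :
    ∃ K : ℝ≥0, ∀ φ : Vec d → Vec d, ContDiff ℝ ∞ φ → tsupport φ ⊆ Ω →
      eLpNorm φ 6 (volume.restrict Ω) ≤ K * eLpNorm (jacobian φ) 2 (volume.restrict Ω) := by
  -- In both dimensions `p` satisfies `1/p - 1/d = 1/6`. For `d = 2` the exponent 2 is excluded by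
  -- `p < d`, so `p = 3/2`, and boundedness of `Ω` then gives `L² ⊆ Lᵖ`.
  obtain ⟨p, hp1, hp2, hpd, hp6⟩ : ∃ p : ℝ≥0, 1 ≤ p ∧ p ≤ 2 ∧ p < d ∧
      (p : ℝ)⁻¹ - (d : ℝ)⁻¹ ≤ ((6 : ℝ≥0) : ℝ)⁻¹ := by
    rcases hd with rfl | rfl
    · refine ⟨3 / 2, ?_, ?_, ?_, ?_⟩
      · rw [← NNReal.coe_le_coe]; push_cast; norm_num
      · rw [← NNReal.coe_le_coe]; push_cast; norm_num
      · rw [← NNReal.coe_lt_coe]; push_cast; norm_num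
      · push_cast; norm_num
    · refine ⟨2, ?_, le_rfl, ?_, ?_⟩
      · rw [← NNReal.coe_le_coe]; push_cast; norm_num
      · rw [← NNReal.coe_lt_coe]; push_cast; norm_num
      · push_cast; norm_num
  have hfin : IsFiniteMeasure (volume.restrict Ω) := ⟨by simpa using hΩb.measure_lt_top⟩
  set m : ℝ≥0∞ := volume.restrict Ω Set.univ ^ (1 / (p : ℝ≥0∞).toReal - 1 / (2 : ℝ≥0∞).toReal) with hm
  have hmt : m ≠ ⊤ := by
    refine ENNReal.rpow_ne_top_of_nonneg ?_ (measure_ne_top _ _)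
    have h1 : (p : ℝ) ≤ 2 := by exact_mod_cast hp2
    have h2 : (0 : ℝ) < p := lt_of_lt_of_le one_pos (by exact_mod_cast hp1)
    simp only [ENNReal.coe_toReal, ENNReal.toReal_ofNat, sub_nonneg]
    exact one_div_le_one_div_of_le h2 h1
  refine ⟨eLpNormLESNormFDerivOfLeConst (Vec d) volume Ω p 6 * m.toNNReal, fun φ hφ hs => ?_⟩
  have hsub : φ.support ⊆ Ω := (subset_tsupport φ).trans hs
  have hfd : Continuous (fderiv ℝ φ) := hφ.continuous_fderiv (by simp)
  have hfs : (fderiv ℝ φ).support ⊆ Ω := (support_fderiv_subset ℝ).trans hs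
  have h1 := eLpNorm_le_eLpNorm_fderiv_of_le (volume : Measure (Vec d)) (hφ.of_le (by simp)) hsub
    (q := 6) hp1 (by simpa using hpd) (by simpa using hp6) hΩb
  calc eLpNorm φ 6 (volume.restrict Ω) = eLpNorm φ (6 : ℝ≥0) volume := by
        rw [eLpNorm_restrict_eq_of_support_subset hsub]; rfl
    _ ≤ _ := h1
    _ = eLpNormLESNormFDerivOfLeConst (Vec d) volume Ω p 6 *
        eLpNorm (fderiv ℝ φ) p (volume.restrict Ω) := by
        congr 1; exact (eLpNorm_restrict_eq_of_support_subset hfs).symm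
    _ ≤ eLpNormLESNormFDerivOfLeConst (Vec d) volume Ω p 6 *
        (eLpNorm (fderiv ℝ φ) 2 (volume.restrict Ω) * m) := by
        gcongr
        exact eLpNorm_le_eLpNorm_mul_rpow_measure_univ (by exact_mod_cast hp2)
          hfd.aestronglyMeasurable
    _ ≤ eLpNormLESNormFDerivOfLeConst (Vec d) volume Ω p 6 *
        (eLpNorm (jacobian φ) 2 (volume.restrict Ω) * m) := by
        gcongr
        exact eLpNorm_mono (norm_fderiv_le_norm_jacobian φ)
    _ = _ := by
        rw [ENNReal.coe_mul, ENNReal.coe_toNNReal hmt]; ring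

/-- Sobolev's inequality `‖v‖_{L⁶} ≤ K ‖∇v‖` on `X`. -/
theorem exists_eLpNorm_vel_six_le {d : ℕ} (hd : d = 2 ∨ d = 3) {Ω : Set (Vec d)}
    (hΩb : Bornology.IsBounded Ω) :
    ∃ K : ℝ≥0, ∀ v : H10 Ω,
      eLpNorm (vel v) 6 (volume.restrict Ω) ≤ K * ‖grad v‖ₑ := by
  obtain ⟨K, hK⟩ := exists_eLpNorm_six_le hd hΩb
  refine ⟨K, fun v => ?_⟩
  have hv : v.1 ∈ closure (testPairs Ω : Set (L2 Ω (Vec d) × L2 Ω (Tens d))) := v.2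
  obtain ⟨P, hP, hlim⟩ := mem_closure_iff_seq_limit.1 hv
  have hl1 : Tendsto (fun n => (P n).1) atTop (𝓝 (vel v)) :=
    (continuous_fst.tendsto _).comp hlim
  have hl2 : Tendsto (fun n => (P n).2) atTop (𝓝 (grad v)) :=
    (continuous_snd.tendsto _).comp hlim
  -- Convergence is known in `L²` only. An a.e. convergent subsequence and Fatou's lemma carry the
  -- `L⁶` bound to the limit.
  obtain ⟨s, hs, hae⟩ := (tendstoInMeasure_of_tendsto_Lp hl1).exists_seq_tendsto_ae
  have hb : ∀ n, eLpNorm (P n).1 6 (volume.restrict Ω) ≤ K * ‖(P n).2‖ₑ := by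
    intro n
    obtain ⟨φ, h1, -, h3, h4, h5⟩ := hP n
    rw [Lp.enorm_def, eLpNorm_congr_ae h4, eLpNorm_congr_ae h5]
    exact hK φ h1 h3
  refine (Lp.eLpNorm_lim_le_liminf_eLpNorm (fun n => Lp.aestronglyMeasurable (P (s n)).1) _
    hae).trans ?_
  refine (liminf_le_liminf (Eventually.of_forall fun n => hb (s n))).trans (le_of_eq ?_)
  refine Tendsto.liminf_eq ?_
  refine ENNReal.Tendsto.const_mul ?_ (Or.inr ENNReal.coe_ne_top)
  exact (continuous_enorm.tendsto _).comp (hl2.comp hs.tendsto_atTop)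

/-- The Poincaré–Friedrichs inequality on `X`. -/
theorem exists_norm_vel_le {d : ℕ} (hd : d = 2 ∨ d = 3) {Ω : Set (Vec d)}
    (hΩb : Bornology.IsBounded Ω) :
    ∃ K : ℝ, 0 ≤ K ∧ ∀ v : H10 Ω, ‖vel v‖ ≤ K * ‖grad v‖ := by
  obtain ⟨K, hK⟩ := exists_eLpNorm_vel_six_le hd hΩb
  have hfin : IsFiniteMeasure (volume.restrict Ω) := ⟨by simpa using hΩb.measure_lt_top⟩
  set m : ℝ≥0∞ :=
    volume.restrict Ω Set.univ ^ (1 / (2 : ℝ≥0∞).toReal - 1 / (6 : ℝ≥0∞).toReal) with hm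
  have hmt : m ≠ ⊤ := ENNReal.rpow_ne_top_of_nonneg (by norm_num) (measure_ne_top _ _)
  refine ⟨K * m.toReal, by positivity, fun v => ?_⟩
  have h : ‖vel v‖ₑ ≤ K * ‖grad v‖ₑ * m := by
    rw [Lp.enorm_def]
    refine (eLpNorm_le_eLpNorm_mul_rpow_measure_univ (q := 6) (by norm_num)
      (Lp.aestronglyMeasurable _)).trans ?_
    gcongr
    exact hK v
  have := ENNReal.toReal_mono (by finiteness) h
  simp only [ENNReal.toReal_mul, toReal_enorm, ENNReal.coe_toReal] at this
  linarith

/-! ### Trilinear integrals: bounds, linearity, continuity -/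

/-- The scalar trilinear integral `∫_Ω u_a (∇v)_b w_c`. -/
def tri {d : ℕ} {Ω : Set (Vec d)} (a : Fin d) (b : Fin d × Fin d) (c : Fin d)
    (u v w : H10 Ω) : ℝ :=
  ∫ x in Ω, vel u x a * grad v x b * vel w x c

section Trilinear

variable {d : ℕ} {Ω : Set (Vec d)} {a : Fin d} {b : Fin d × Fin d} {c : Fin d}

theorem lintegral_enorm_tri_le {K : ℝ≥0}
    (hK : ∀ v : H10 Ω, eLpNorm (vel v) 6 (volume.restrict Ω) ≤ K * ‖grad v‖ₑ) (u v w : H10 Ω) :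
    ∫⁻ x in Ω, ‖vel u x a * grad v x b * vel w x c‖ₑ ≤
      K * ‖grad u‖ₑ * ‖grad v‖ₑ * ((K * ‖grad w‖ₑ) ^ (1 / 2 : ℝ) * ‖vel w‖ₑ ^ (1 / 2 : ℝ)) := by
  have hcomp : ∀ {ι : Type} [Fintype ι] (y : EuclideanSpace ℝ ι) (i : ι), ‖y i‖ₑ ≤ ‖y‖ₑ :=
    fun y i => enorm_le_iff_norm_le.2 (PiLp.norm_apply_le y i)
  calc ∫⁻ x in Ω, ‖vel u x a * grad v x b * vel w x c‖ₑ
      ≤ ∫⁻ x in Ω, ‖vel u x‖ₑ * ‖grad v x‖ₑ * ‖vel w x‖ₑ := by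
        refine lintegral_mono fun x => ?_
        rw [enorm_mul, enorm_mul]
        gcongr <;> exact hcomp _ _
    _ ≤ _ := lintegral_mul_mul_le (Lp.aestronglyMeasurable _) (Lp.aestronglyMeasurable _)
        (Lp.aestronglyMeasurable _)
    _ ≤ _ := by
        rw [← Lp.enorm_def, ← Lp.enorm_def]
        gcongr
        · exact hK u
        · exact hK w

theorem integrable_tri {K : ℝ≥0}
    (hK : ∀ v : H10 Ω, eLpNorm (vel v) 6 (volume.restrict Ω) ≤ K * ‖grad v‖ₑ) (u v w : H10 Ω) :
    Integrable (fun x => vel u x a * grad v x b * vel w x c) (volume.restrict Ω) := by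
  have hm : ∀ {ι : Type} [Fintype ι] (P : L2 Ω (EuclideanSpace ℝ ι)) (i : ι),
      AEStronglyMeasurable (fun x => P x i) (volume.restrict Ω) := fun {ι} _ P i =>
    (EuclideanSpace.proj i : EuclideanSpace ℝ ι →L[ℝ] ℝ).continuous.comp_aestronglyMeasurable
      (Lp.aestronglyMeasurable P)
  refine ⟨((hm _ _).mul (hm _ _)).mul (hm _ _), (lintegral_enorm_tri_le hK u v w).trans_lt ?_⟩
  finiteness

theorem abs_tri_le {K : ℝ≥0}
    (hK : ∀ v : H10 Ω, eLpNorm (vel v) 6 (volume.restrict Ω) ≤ K * ‖grad v‖ₑ) (u v w : H10 Ω) :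
    |tri a b c u v w| ≤ (K * √K) * (‖grad u‖ * ‖grad v‖ * √(‖grad w‖ * ‖vel w‖)) := by
  have h := (enorm_integral_le_lintegral_enorm (μ := volume.restrict Ω)
    (fun x => vel u x a * grad v x b * vel w x c)).trans (lintegral_enorm_tri_le hK u v w)
  have h' := ENNReal.toReal_mono (by finiteness) h
  simp only [ENNReal.toReal_mul, toReal_enorm, ENNReal.coe_toReal, ← ENNReal.toReal_rpow,
    ← Real.sqrt_eq_rpow, Real.norm_eq_abs] at h'
  refine h'.trans (le_of_eq ?_)
  rw [Real.sqrt_mul (by positivity), Real.sqrt_mul (by positivity)]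
  ring

/-- A cruder bound in the norm of `X`, the maximum of the two `L²` norms. It yields the continuity
in each slot on which the density argument rests. -/
theorem abs_tri_le_norm {K : ℝ≥0}
    (hK : ∀ v : H10 Ω, eLpNorm (vel v) 6 (volume.restrict Ω) ≤ K * ‖grad v‖ₑ) (u v w : H10 Ω) :
    |tri a b c u v w| ≤ (K * √K) * (‖u‖ * ‖v‖ * ‖w‖) := by
  refine (abs_tri_le hK u v w).trans ?_
  have hg : ∀ z : H10 Ω, ‖grad z‖ ≤ ‖z‖ := fun z => norm_snd_le z.1
  have hv : ∀ z : H10 Ω, ‖vel z‖ ≤ ‖z‖ := fun z => norm_fst_le z.1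
  have hs : √(‖grad w‖ * ‖vel w‖) ≤ ‖w‖ := by
    refine Real.sqrt_le_iff.2 ⟨norm_nonneg _, ?_⟩
    rw [sq]
    exact mul_le_mul (hg w) (hv w) (norm_nonneg _) (norm_nonneg _)
  gcongr
  · exact hg u
  · exact hg v

theorem vel_add_apply_ae (u v : H10 Ω) :
    ∀ᵐ x ∂volume.restrict Ω, ∀ i, vel (u + v) x i = vel u x i + vel v x i := by
  filter_upwards [Lp.coeFn_add (vel u) (vel v)] with x hx i
  show (vel u + vel v : L2 Ω (Vec d)) x i = _
  rw [hx]; rfl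

theorem vel_smul_apply_ae (r : ℝ) (u : H10 Ω) :
    ∀ᵐ x ∂volume.restrict Ω, ∀ i, vel (r • u) x i = r * vel u x i := by
  filter_upwards [Lp.coeFn_smul r (vel u)] with x hx i
  show (r • vel u : L2 Ω (Vec d)) x i = _
  rw [hx]; rfl

theorem grad_add_apply_ae (u v : H10 Ω) :
    ∀ᵐ x ∂volume.restrict Ω, ∀ i, grad (u + v) x i = grad u x i + grad v x i := by
  filter_upwards [Lp.coeFn_add (grad u) (grad v)] with x hx i
  show (grad u + grad v : L2 Ω (Tens d)) x i = _
  rw [hx]; rfl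

theorem grad_smul_apply_ae (r : ℝ) (u : H10 Ω) :
    ∀ᵐ x ∂volume.restrict Ω, ∀ i, grad (r • u) x i = r * grad u x i := by
  filter_upwards [Lp.coeFn_smul r (grad u)] with x hx i
  show (r • grad u : L2 Ω (Tens d)) x i = _
  rw [hx]; rfl

/-- Additivity of the integral needs `integrable_tri`, hence Sobolev's inequality; likewise in the
other two slots. -/
theorem isLinearMap_tri_left {K : ℝ≥0}
    (hK : ∀ v : H10 Ω, eLpNorm (vel v) 6 (volume.restrict Ω) ≤ K * ‖grad v‖ₑ) (v w : H10 Ω) :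
    IsLinearMap ℝ fun u => tri a b c u v w where
  map_add u u' := by
    unfold tri
    rw [← integral_add (integrable_tri hK u v w) (integrable_tri hK u' v w)]
    refine integral_congr_ae ?_
    filter_upwards [vel_add_apply_ae u u'] with x hx
    rw [hx]; ring
  map_smul r u := by
    unfold tri
    rw [smul_eq_mul, ← integral_const_mul]
    refine integral_congr_ae ?_
    filter_upwards [vel_smul_apply_ae r u] with x hx
    rw [hx]; ring

theorem isLinearMap_tri_mid {K : ℝ≥0}
    (hK : ∀ v : H10 Ω, eLpNorm (vel v) 6 (volume.restrict Ω) ≤ K * ‖grad v‖ₑ) (u w : H10 Ω) :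
    IsLinearMap ℝ fun v => tri a b c u v w where
  map_add v v' := by
    unfold tri
    rw [← integral_add (integrable_tri hK u v w) (integrable_tri hK u v' w)]
    refine integral_congr_ae ?_
    filter_upwards [grad_add_apply_ae v v'] with x hx
    rw [hx]; ring
  map_smul r v := by
    unfold tri
    rw [smul_eq_mul, ← integral_const_mul]
    refine integral_congr_ae ?_
    filter_upwards [grad_smul_apply_ae r v] with x hx
    rw [hx]; ring

theorem isLinearMap_tri_right {K : ℝ≥0}
    (hK : ∀ v : H10 Ω, eLpNorm (vel v) 6 (volume.restrict Ω) ≤ K * ‖grad v‖ₑ) (u v : H10 Ω) :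
    IsLinearMap ℝ fun w => tri a b c u v w where
  map_add w w' := by
    unfold tri
    rw [← integral_add (integrable_tri hK u v w) (integrable_tri hK u v w')]
    refine integral_congr_ae ?_
    filter_upwards [vel_add_apply_ae w w'] with x hx
    rw [hx]; ring
  map_smul r w := by
    unfold tri
    rw [smul_eq_mul, ← integral_const_mul]
    refine integral_congr_ae ?_
    filter_upwards [vel_smul_apply_ae r w] with x hx
    rw [hx]; ring

theorem _root_.IsLinearMap.continuous_of_abs_le {E : Type*} [NormedAddCommGroup E]
    [NormedSpace ℝ E] {g : E → ℝ} (hg : IsLinearMap ℝ g) {M : ℝ} (hM : ∀ x, |g x| ≤ M * ‖x‖) :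
    Continuous g :=
  AddMonoidHomClass.continuous_of_bound (hg.mk' g) M hM

theorem continuous_tri_left {K : ℝ≥0}
    (hK : ∀ v : H10 Ω, eLpNorm (vel v) 6 (volume.restrict Ω) ≤ K * ‖grad v‖ₑ) (v w : H10 Ω) :
    Continuous fun u => tri a b c u v w :=
  (isLinearMap_tri_left hK v w).continuous_of_abs_le (M := K * √K * (‖v‖ * ‖w‖)) fun u =>
    (abs_tri_le_norm hK u v w).trans (le_of_eq (by ring))

theorem continuous_tri_mid {K : ℝ≥0}
    (hK : ∀ v : H10 Ω, eLpNorm (vel v) 6 (volume.restrict Ω) ≤ K * ‖grad v‖ₑ) (u w : H10 Ω) :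
    Continuous fun v => tri a b c u v w :=
  (isLinearMap_tri_mid hK u w).continuous_of_abs_le (M := K * √K * (‖u‖ * ‖w‖)) fun v =>
    (abs_tri_le_norm hK u v w).trans (le_of_eq (by ring))

theorem continuous_tri_right {K : ℝ≥0}
    (hK : ∀ v : H10 Ω, eLpNorm (vel v) 6 (volume.restrict Ω) ≤ K * ‖grad v‖ₑ) (u v : H10 Ω) :
    Continuous fun w => tri a b c u v w :=
  (isLinearMap_tri_right hK u v).continuous_of_abs_le (M := K * √K * (‖u‖ * ‖v‖)) fun w =>
    (abs_tri_le_norm hK u v w).trans (le_of_eq (by ring))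

/-! ### Density and integration by parts -/

/-- A closed property that holds for test fields holds on all of `X`. -/
theorem H10_induction {p : H10 Ω → Prop} (hp : IsClosed {v | p v})
    (h : ∀ v : H10 Ω, v.1 ∈ testPairs Ω → p v) (v : H10 Ω) : p v := by
  have hv : v ∈ closure {v : H10 Ω | v.1 ∈ testPairs Ω} := by
    rw [closure_subtype]
    have hv' : v.1 ∈ closure (testPairs Ω : Set (L2 Ω (Vec d) × L2 Ω (Tens d))) := v.2
    refine closure_mono (fun P hP => ?_) hv'
    exact ⟨⟨P, (testPairs Ω).le_topologicalClosure hP⟩, hP, rfl⟩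
  exact closure_minimal h hp hv

/-- The first factor vanishes off `Ω`, so the integral extends to the whole space whatever `ψ` and
`χ` do there. -/
theorem tri_eq_integral {u v w : H10 Ω} {φ ψ χ : Vec d → Vec d} (hφs : tsupport φ ⊆ Ω)
    (hu : vel u =ᵐ[volume.restrict Ω] φ) (hv : grad v =ᵐ[volume.restrict Ω] jacobian ψ)
    (hw : vel w =ᵐ[volume.restrict Ω] χ) :
    tri a b c u v w =
      ∫ x, φ x a * fderiv ℝ ψ x (EuclideanSpace.single b.2 1) b.1 * χ x c := by
  unfold tri
  rw [integral_congr_ae (g := fun x =>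
    φ x a * fderiv ℝ ψ x (EuclideanSpace.single b.2 1) b.1 * χ x c)
    (by filter_upwards [hu, hv, hw] with x h1 h2 h3; rw [h1, h2, h3]; rfl)]
  refine setIntegral_eq_integral_of_forall_compl_eq_zero fun x hx => ?_
  rw [image_eq_zero_of_notMem_tsupport (fun h => hx (hφs h))]; simp

/-- Integration by parts for smooth compactly supported fields. -/
theorem integral_mul_fderiv_mul_add_eq_zero {φ ψ χ : Vec d → Vec d} (hφ : ContDiff ℝ ∞ φ)
    (hψ : ContDiff ℝ ∞ ψ) (hχ : ContDiff ℝ ∞ χ) (cφ : HasCompactSupport φ)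
    (cψ : HasCompactSupport ψ) (i k : Fin d) :
    (∫ x, φ x k * fderiv ℝ χ x (EuclideanSpace.single k 1) i * ψ x i)
      + (∫ x, φ x k * fderiv ℝ ψ x (EuclideanSpace.single k 1) i * χ x i)
      + (∫ x, ψ x i * fderiv ℝ φ x (EuclideanSpace.single k 1) k * χ x i) = 0 := by
  have hcomp : ∀ {η : Vec d → Vec d}, ContDiff ℝ ∞ η → ∀ l, ContDiff ℝ ∞ fun x => η x l :=
    fun hη l => (EuclideanSpace.proj l : Vec d →L[ℝ] ℝ).contDiff.comp hη
  have hf : ∀ {η : Vec d → Vec d}, ContDiff ℝ ∞ η → ∀ l x,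
      fderiv ℝ (fun x => η x l) x (EuclideanSpace.single k 1) =
        fderiv ℝ η x (EuclideanSpace.single k 1) l := by
    intro η hη l x
    have := ((EuclideanSpace.proj l : Vec d →L[ℝ] ℝ).hasFDerivAt.comp x
      (hη.differentiable (by simp) x).hasFDerivAt).fderiv
    have e : (fun x => η x l) = (EuclideanSpace.proj l : Vec d →L[ℝ] ℝ) ∘ η := rfl
    rw [e, this]; rfl
  have hD : ∀ {η : Vec d → Vec d}, ContDiff ℝ ∞ η → ∀ l,
      Continuous fun x => fderiv ℝ η x (EuclideanSpace.single k 1) l := fun hη l =>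
    (EuclideanSpace.proj l : Vec d →L[ℝ] ℝ).continuous.comp
      ((hη.continuous_fderiv (by simp)).clm_apply continuous_const)
  have hcs : ∀ {η : Vec d → Vec d}, HasCompactSupport η → ∀ l,
      HasCompactSupport fun x => η x l := fun hη l =>
    hη.comp_left (g := fun y : Vec d => y l) rfl
  have cont : ∀ {η : Vec d → Vec d}, ContDiff ℝ ∞ η → ∀ l, Continuous fun x => η x l :=
    fun hη l => (hcomp hη l).continuous
  have hprod : ∀ x, fderiv ℝ (fun x => φ x k * ψ x i) x (EuclideanSpace.single k 1) =
      φ x k * fderiv ℝ ψ x (EuclideanSpace.single k 1) i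
        + ψ x i * fderiv ℝ φ x (EuclideanSpace.single k 1) k := by
    intro x
    rw [fderiv_fun_mul ((hcomp hφ k).differentiable (by simp) x)
      ((hcomp hψ i).differentiable (by simp) x)]
    simp only [add_apply, smul_apply, smul_eq_mul,
      hf hφ, hf hψ]
  have I1 : Integrable fun x => φ x k * fderiv ℝ ψ x (EuclideanSpace.single k 1) i * χ x i :=
    (((cont hφ k).mul (hD hψ i)).mul (cont hχ i)).integrable_of_hasCompactSupport
      ((hcs cφ k).mul_right.mul_right)
  have I2 : Integrable fun x => ψ x i * fderiv ℝ φ x (EuclideanSpace.single k 1) k * χ x i :=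
    (((cont hψ i).mul (hD hφ k)).mul (cont hχ i)).integrable_of_hasCompactSupport
      ((hcs cψ i).mul_right.mul_right)
  -- The derivative `∂ₖ` is moved from `χᵢ` onto the product `φₖ ψᵢ`.
  have ibp := integral_mul_fderiv_eq_neg_fderiv_mul_of_integrable (μ := (volume : Measure (Vec d)))
    (f := fun x => φ x k * ψ x i) (g := fun x => χ x i) (v := EuclideanSpace.single k 1)
    (by simp only [hprod, add_mul]; exact I1.add I2)
    (by
      simp only [hf hχ]
      exact (((cont hφ k).mul (cont hψ i)).mul (hD hχ i)).integrable_of_hasCompactSupport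
        ((hcs cφ k).mul_right.mul_right))
    ((((cont hφ k).mul (cont hψ i)).mul (cont hχ i)).integrable_of_hasCompactSupport
        ((hcs cφ k).mul_right.mul_right))
    (fun x _ => ((hcomp hφ k).mul (hcomp hψ i)).differentiable (by simp) x)
    (fun x _ => (hcomp hχ i).differentiable (by simp) x)
  simp only [hprod, hf hχ, add_mul] at ibp
  rw [integral_add I1 I2] at ibp
  have e : (∫ x, φ x k * fderiv ℝ χ x (EuclideanSpace.single k 1) i * ψ x i) =
      ∫ x, φ x k * ψ x i * fderiv ℝ χ x (EuclideanSpace.single k 1) i :=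
    integral_congr_ae (Eventually.of_forall fun x => by ring)
  rw [e, ibp]; ring

/-- Integration by parts on `X`:
`∫ uₖ (∂ₖ wᵢ) vᵢ + ∫ uₖ (∂ₖ vᵢ) wᵢ + ∫ vᵢ (∂ₖ uₖ) wᵢ = 0`. -/
theorem tri_add_tri_add_tri_eq_zero {K : ℝ≥0}
    (hK : ∀ v : H10 Ω, eLpNorm (vel v) 6 (volume.restrict Ω) ≤ K * ‖grad v‖ₑ) (i k : Fin d)
    (u v w : H10 Ω) :
    tri k (i, k) i u w v + tri k (i, k) i u v w + tri i (k, k) i v u w = 0 := by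
  -- Continuity is separate in each argument, so density is used one argument at a time, those
  -- already treated staying fixed as test fields.
  revert w
  refine H10_induction (isClosed_eq (((continuous_tri_mid hK u v).add
    (continuous_tri_right hK u v)).add (continuous_tri_right hK v u)) continuous_const) ?_
  rintro w ⟨χ, w1, w2, w3, w4, w5⟩
  revert v
  refine H10_induction (isClosed_eq (((continuous_tri_right hK u w).add
    (continuous_tri_mid hK u w)).add (continuous_tri_left hK u w)) continuous_const) ?_
  rintro v ⟨ψ, v1, v2, v3, v4, v5⟩
  revert u
  refine H10_induction (isClosed_eq (((continuous_tri_left hK w v).add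
    (continuous_tri_left hK v w)).add (continuous_tri_mid hK v w)) continuous_const) ?_
  rintro u ⟨φ, u1, u2, u3, u4, u5⟩
  rw [tri_eq_integral u3 u4 w5 v4, tri_eq_integral u3 u4 v5 w4, tri_eq_integral v3 v4 u5 w4]
  exact integral_mul_fderiv_mul_add_eq_zero u1 v1 w1 u2 v2 i k

/-! ### Estimates for the skew-symmetric form -/

theorem convect_eq_sum_tri {K : ℝ≥0}
    (hK : ∀ v : H10 Ω, eLpNorm (vel v) 6 (volume.restrict Ω) ≤ K * ‖grad v‖ₑ) (u v w : H10 Ω) :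
    convect u v w = ∑ i, ∑ k, tri k (i, k) i u v w := by
  unfold convect tri
  rw [integral_finsetSum]
  · exact Finset.sum_congr rfl fun i _ =>
      integral_finsetSum _ fun k _ => integrable_tri hK u v w
  · exact fun i _ => integrable_finsetSum _ fun k _ => integrable_tri hK u v w

/-- The diagonal part `b*(u, v, v)` vanishes by skew symmetry, without any condition on the
divergence of `u`. -/
theorem bStar_sub_mid {K : ℝ≥0}
    (hK : ∀ v : H10 Ω, eLpNorm (vel v) 6 (volume.restrict Ω) ≤ K * ‖grad v‖ₑ)
    (u v w : H10 Ω) : bStar u (v - w) v = - bStar u w v := by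
  have hm : ∀ i k, tri k (i, k) i u (v - w) v = tri k (i, k) i u v v - tri k (i, k) i u w v :=
    fun i k => (isLinearMap_tri_mid hK u v).map_sub v w
  have hr : ∀ i k, tri k (i, k) i u v (v - w) = tri k (i, k) i u v v - tri k (i, k) i u v w :=
    fun i k => (isLinearMap_tri_right hK u v).map_sub v w
  simp only [bStar, convect_eq_sum_tri hK, hm, hr, Finset.sum_sub_distrib]
  ring

/-- The bound `|b*(u, w, v)| ≤ M ‖∇u‖ ‖∇v‖ ‖∇w‖^{1/2} ‖w‖^{1/2}`. -/
theorem abs_bStar_le {K : ℝ≥0}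
    (hK : ∀ v : H10 Ω, eLpNorm (vel v) 6 (volume.restrict Ω) ≤ K * ‖grad v‖ₑ)
    (u w v : H10 Ω) :
    |bStar u w v| ≤
      3 / 2 * d ^ 2 * (K * √K) * (‖grad u‖ * ‖grad v‖ * √(‖grad w‖ * ‖vel w‖)) := by
  -- By parts, `b*(u, w, v) = -(u·∇v, w) - ½((∇·u) v, w)`, free of `∇w`. The weights `1 + 1/2` give
  -- the factor `3/2`, the pairs `(i, k)` the factor `d²`.
  have e : bStar u w v =
      ∑ i, ∑ k, (-(1 / 2 * tri i (k, k) i v u w) - tri k (i, k) i u v w) := by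
    simp only [bStar, convect_eq_sum_tri hK, Finset.mul_sum, ← Finset.sum_sub_distrib]
    refine Finset.sum_congr rfl fun i _ => Finset.sum_congr rfl fun k _ => ?_
    linarith [tri_add_tri_add_tri_eq_zero hK i k u v w]
  rw [e]
  set T := K * √K * (‖grad u‖ * ‖grad v‖ * √(‖grad w‖ * ‖vel w‖)) with hT
  have hterm : ∀ i k : Fin d,
      |-(1 / 2 * tri i (k, k) i v u w) - tri k (i, k) i u v w| ≤ 3 / 2 * T := by
    intro i k
    have h1 : |tri i (k, k) i v u w| ≤ T :=
      (abs_tri_le hK v u w).trans (le_of_eq (by rw [hT]; ring))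
    have h2 : |tri k (i, k) i u v w| ≤ T := abs_tri_le hK u v w
    rw [abs_le] at h1 h2 ⊢
    constructor <;> linarith [h1.1, h1.2, h2.1, h2.2]
  refine (Finset.abs_sum_le_sum_abs _ _).trans ?_
  refine (Finset.sum_le_sum fun i _ => (Finset.abs_sum_le_sum_abs _ _).trans
    (Finset.sum_le_sum fun k _ => hterm i k)).trans (le_of_eq ?_)
  simp only [Finset.sum_const, Finset.card_univ, Fintype.card_fin, nsmul_eq_mul, hT]
  ring

end Trilinear

/-! ### Dual norm, G-stability and absorption of the fluctuation -/

/-- The dual norm inequality `(f, v) ≤ ‖f‖₋₁ ‖∇v‖`. -/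
theorem apply_le_negNorm_mul {d : ℕ} (hd : d = 2 ∨ d = 3) {Ω : Set (Vec d)}
    (hΩb : Bornology.IsBounded Ω) (f : H10 Ω →L[ℝ] ℝ) (v : H10 Ω) :
    f v ≤ negNorm f * ‖grad v‖ := by
  obtain ⟨K, hK0, hK⟩ := exists_norm_vel_le hd hΩb
  have hn : ∀ v : H10 Ω, ‖v‖ ≤ (K + 1) * ‖grad v‖ := by
    intro v
    have h0 := norm_nonneg (grad v)
    refine max_le ((hK v).trans (by linarith)) ?_
    show ‖grad v‖ ≤ _
    nlinarith [mul_nonneg hK0 h0]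
  by_cases h0 : v = 0
  · subst h0
    have : grad (0 : H10 Ω) = 0 := rfl
    simp [this]
  have hpos : ∀ v : H10 Ω, v ≠ 0 → 0 < ‖grad v‖ := by
    intro v hv
    by_contra hle
    have : ‖grad v‖ = 0 := le_antisymm (not_lt.1 hle) (norm_nonneg _)
    have h1 := hn v
    rw [this, mul_zero] at h1
    exact hv (norm_le_zero_iff.1 h1)
  rw [← div_le_iff₀ (hpos v h0)]
  refine le_ciSup (f := fun v : {v : H10 Ω // v ≠ 0} => f v.1 / ‖grad v.1‖) ?_ ⟨v, h0⟩
  -- Boundedness of the quotients has to be shown, as the supremum of an unbounded set of reals is 0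
  -- by convention; it follows from Poincaré's inequality.
  refine ⟨‖f‖ * (K + 1), ?_⟩
  rintro _ ⟨w, rfl⟩
  show f w.1 / ‖grad w.1‖ ≤ _
  rw [div_le_iff₀ (hpos w.1 w.2), mul_assoc]
  refine (le_abs_self _).trans ((f.le_opNorm w.1).trans ?_)
  gcongr
  exact hn w.1

/-- The `G`-stability identity of the blended BDF scheme. -/
theorem inner_blended_eq {H : Type*} [NormedAddCommGroup H] [InnerProductSpace ℝ H]
    (a b c e : H) :
    1 / 6 * inner ℝ ((10 : ℝ) • a - (15 : ℝ) • b + (6 : ℝ) • c - e) a =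
      1 / 12 * ‖a‖ ^ 2 + 1 / 12 * ‖(3 : ℝ) • a - b‖ ^ 2
        + 1 / 12 * ‖(3 : ℝ) • a - (3 : ℝ) • b + c‖ ^ 2
      - (1 / 12 * ‖b‖ ^ 2 + 1 / 12 * ‖(3 : ℝ) • b - c‖ ^ 2
        + 1 / 12 * ‖(3 : ℝ) • b - (3 : ℝ) • c + e‖ ^ 2)
      + 1 / 12 * ‖a - (3 : ℝ) • b + (3 : ℝ) • c - e‖ ^ 2 := by
  simp only [← real_inner_self_eq_norm_sq, inner_add_left, inner_add_right, inner_sub_left,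
    inner_sub_right, real_inner_smul_left, real_inner_smul_right, real_inner_comm a b,
    real_inner_comm a c, real_inner_comm a e, real_inner_comm b c, real_inner_comm b e,
    real_inner_comm c e]
  ring

/-- The fluctuation term is absorbed under the time step restriction, for fields obeying an
inverse inequality. -/
theorem mul_abs_bStar_le {d : ℕ} {Ω : Set (Vec d)} {K : ℝ≥0}
    (hK : ∀ v : H10 Ω, eLpNorm (vel v) 6 (volume.restrict Ω) ≤ K * ‖grad v‖ₑ)
    {h Cinv ν Δt C : ℝ} (hh : 0 < h) (hCinv : 0 < Cinv) (hν : 0 < ν) (hΔt : 0 < Δt)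
    (hC : 24 * (3 / 2 * d ^ 2 * (K * √K)) ^ 2 * Cinv ≤ C) {u w v : H10 Ω}
    (hw : h * ‖grad w‖ ≤ Cinv * ‖vel w‖) (hu : C * (Δt / (ν * h)) * ‖grad u‖ ^ 2 ≤ 1) :
    Δt * |bStar u w v| ≤ 1 / 24 * ‖vel w‖ ^ 2 + Δt / 4 * (ν * ‖grad v‖ ^ 2) := by
  have hb := abs_bStar_le hK u w v
  set M : ℝ := 3 / 2 * d ^ 2 * (K * √K) with hM
  have hM0 : 0 ≤ M := by positivity
  have hs : √(‖grad w‖ * ‖vel w‖) ≤ √(Cinv / h) * ‖vel w‖ := by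
    refine Real.sqrt_le_iff.2 ⟨by positivity, ?_⟩
    rw [mul_pow, Real.sq_sqrt (by positivity), sq, ← mul_assoc]
    refine mul_le_mul_of_nonneg_right ?_ (norm_nonneg _)
    rw [div_mul_eq_mul_div, le_div_iff₀ hh]
    linarith
  have hb' : Δt * |bStar u w v| ≤
      (Δt * M * √(Cinv / h) * ‖grad u‖ * ‖grad v‖) * ‖vel w‖ := by
    calc Δt * |bStar u w v| ≤ Δt * (M * (‖grad u‖ * ‖grad v‖ * (√(Cinv / h) * ‖vel w‖))) := by
          gcongr
          exact hb.trans (by gcongr)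
      _ = _ := by ring
  set A := Δt * M * √(Cinv / h) * ‖grad u‖ * ‖grad v‖ with hA
  -- Young's inequality will be used as `A‖w‖ ≤ ‖w‖²/24 + 6A²`. Requiring `6A²` to fit into a
  -- quarter of the viscous term produces the threshold `24 M² Cinv` for `C`.
  have hA2 : 6 * A ^ 2 ≤ Δt / 4 * (ν * ‖grad v‖ ^ 2) := by
    have e : 6 * A ^ 2 = Δt / 4 * (ν * ‖grad v‖ ^ 2) *
        (24 * M ^ 2 * Cinv * (Δt / (ν * h)) * ‖grad u‖ ^ 2) := by
      rw [hA]
      simp only [mul_pow]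
      rw [Real.sq_sqrt (by positivity)]
      field_simp
      ring
    have h1 : 24 * M ^ 2 * Cinv * (Δt / (ν * h)) * ‖grad u‖ ^ 2 ≤ 1 := by
      refine le_trans ?_ hu
      gcongr
    rw [e]
    exact mul_le_of_le_one_right (by positivity) h1
  nlinarith [sq_nonneg (12 * A - ‖vel w‖)]

/-! ### One-step energy estimate and summation -/

theorem vel_add {d : ℕ} {Ω : Set (Vec d)} (v w : H10 Ω) : vel (v + w) = vel v + vel w := rfl

theorem vel_sub {d : ℕ} {Ω : Set (Vec d)} (v w : H10 Ω) : vel (v - w) = vel v - vel w := rfl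

theorem vel_smul {d : ℕ} {Ω : Set (Vec d)} (r : ℝ) (v : H10 Ω) : vel (r • v) = r • vel v := rfl

/-- The energy `‖wⁿ‖²/12 + ‖3wⁿ - wⁿ⁻¹‖²/12 + ‖3wⁿ - 3wⁿ⁻¹ + wⁿ⁻²‖²/12`. -/
def energy {d : ℕ} {Ω : Set (Vec d)} (w : ℕ → H10 Ω) (n : ℕ) : ℝ :=
  1 / 12 * ‖vel (w n)‖ ^ 2 + 1 / 12 * ‖vel ((3 : ℝ) • w n - w (n - 1))‖ ^ 2
    + 1 / 12 * ‖vel ((3 : ℝ) • w n - (3 : ℝ) • w (n - 1) + w (n - 2))‖ ^ 2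

theorem mul_inner_blendedBDF_eq {d : ℕ} {Ω : Set (Vec d)} {Δt : ℝ} (hΔt : Δt ≠ 0)
    (w : ℕ → H10 Ω) (n : ℕ) :
    Δt * inner ℝ (vel (blendedBDF Δt w n)) (vel (w (n + 1))) =
      energy w (n + 1) - energy w n
        + 1 / 12 * ‖vel (w (n + 1) - (3 : ℝ) • w n + (3 : ℝ) • w (n - 1) - w (n - 2))‖ ^ 2 := by
  have e2 : n + 1 - 2 = n - 1 := by omega
  simp only [energy, blendedBDF, vel_add, vel_sub, vel_smul, Nat.add_sub_cancel, e2]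
  rw [← inner_blended_eq, real_inner_smul_left]
  field_simp

theorem mul_apply_le {d : ℕ} (hd : d = 2 ∨ d = 3) {Ω : Set (Vec d)}
    (hΩb : Bornology.IsBounded Ω) {ν Δt : ℝ} (hν : 0 < ν) (hΔt : 0 < Δt)
    (f : H10 Ω →L[ℝ] ℝ) (v : H10 Ω) :
    Δt * f v ≤ Δt / ν * negNorm f ^ 2 + Δt / 4 * (ν * ‖grad v‖ ^ 2) := by
  refine (mul_le_mul_of_nonneg_left (apply_le_negNorm_mul hd hΩb f v) hΔt.le).trans ?_
  have h2 : Δt / ν * negNorm f ^ 2 + Δt / 4 * (ν * ‖grad v‖ ^ 2) - Δt * (negNorm f * ‖grad v‖)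
      = Δt / ν * (negNorm f - ν / 2 * ‖grad v‖) ^ 2 := by
    field_simp
    ring
  have h3 : 0 ≤ Δt / ν * (negNorm f - ν / 2 * ‖grad v‖) ^ 2 := by positivity
  linarith

/-- The arithmetic of the energy estimate over one time step. -/
theorem energy_balance {ν Δt I B₀ B₁ P G F B W E₁ E₀ g R : ℝ} (hν : 0 < ν) (hΔt : 0 < Δt)
    (hmom : I + B₀ + B₁ - P + ν * G = F) (hB₀ : B₀ = 0) (hB₁ : B₁ = -B) (hP : P = 0)
    (hG : G = g ^ 2) (hI : Δt * I = E₁ - E₀ + 1 / 12 * W)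
    (hB : Δt * |B| ≤ 1 / 24 * W + Δt / 4 * (ν * g ^ 2))
    (hF : Δt * F ≤ R + Δt / 4 * (ν * g ^ 2)) :
    E₁ + 1 / 24 * W + Δt / 4 * (ν * g ^ 2) ≤ E₀ + R := by
  subst hB₀ hB₁ hP hG hmom
  have hle : Δt * B ≤ Δt * |B| := mul_le_mul_of_nonneg_left (le_abs_self _) hΔt.le
  -- The fluctuation and the forcing each use a quarter of the viscous term. Half remains, of which
  -- a quarter is kept and the surplus dropped.
  have hg : 0 ≤ Δt * (ν * g ^ 2) := by positivity
  linarith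

/-- The energy estimate over one time step. -/
theorem energy_succ_le {d J NT : ℕ} (hd : d = 2 ∨ d = 3) {Ω : Set (Vec d)}
    (hΩb : Bornology.IsBounded Ω) {K : ℝ≥0}
    (hK : ∀ v : H10 Ω, eLpNorm (vel v) 6 (volume.restrict Ω) ≤ K * ‖grad v‖ₑ)
    {h Cinv ν Δt C : ℝ} (hh : 0 < h) (hCinv : 0 < Cinv) (hν : 0 < ν) (hΔt : 0 < Δt)
    (hC : 24 * (3 / 2 * d ^ 2 * (K * √K)) ^ 2 * Cinv ≤ C)
    {Xh : Submodule ℝ (H10 Ω)} {Qh : Submodule ℝ (L2 Ω ℝ)}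
    (hinv : ∀ v ∈ Xh, h * ‖grad v‖ ≤ Cinv * ‖vel v‖)
    {f : Fin J → ℕ → (H10 Ω →L[ℝ] ℝ)} {u : Fin J → ℕ → H10 Ω} {p : Fin J → ℕ → L2 Ω ℝ}
    (hsol : IsSchemeSolution Xh Qh ν Δt f NT u p) {j : Fin J} {n : ℕ} (hn : 2 ≤ n) (hnN : n < NT)
    (hfl : C * (Δt / (ν * h)) * ‖grad (fluct u j n)‖ ^ 2 ≤ 1) :
    energy (u j) (n + 1)
      + 1 / 24 * ‖vel (u j (n + 1) - (3 : ℝ) • u j n + (3 : ℝ) • u j (n - 1) - u j (n - 2))‖ ^ 2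
      + Δt / 4 * (ν * ‖grad (u j (n + 1))‖ ^ 2)
    ≤ energy (u j) n + Δt / ν * negNorm (f j (n + 1)) ^ 2 := by
  obtain ⟨w, hw⟩ : ∃ w, w = u j (n + 1) - (3 : ℝ) • u j n + (3 : ℝ) • u j (n - 1) - u j (n - 2) :=
    ⟨_, rfl⟩
  have haX : u j (n + 1) ∈ Xh := hsol.vel_mem j _ (by omega)
  -- The inverse inequality is applied to the third difference, so all four time levels must lie in
  -- `Xh`.
  have hwX : w ∈ Xh := by
    rw [hw]
    exact Xh.sub_mem (Xh.add_mem (Xh.sub_mem haX (Xh.smul_mem _ (hsol.vel_mem j _ (by omega))))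
      (Xh.smul_mem _ (hsol.vel_mem j _ (by omega)))) (hsol.vel_mem j _ (by omega))
  have hskew : bStar (mean u n) (u j (n + 1)) (u j (n + 1)) = 0 := sub_self _
  have hpres : inner ℝ (p j (n + 1)) (div (u j (n + 1))) = 0 :=
    (real_inner_comm _ _).trans (hsol.mass j n hn hnN _ (hsol.pres_mem j n hn hnN))
  have hex : extrap (u j) n = u j (n + 1) - w := by
    rw [hw, extrap]; abel
  have hfluct : bStar (fluct u j n) (extrap (u j) n) (u j (n + 1)) =
      -bStar (fluct u j n) w (u j (n + 1)) :=
    hex ▸ bStar_sub_mid hK _ _ _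
  have hbdf := mul_inner_blendedBDF_eq hΔt.ne' (u j) n
  rw [← hw] at hbdf ⊢
  exact energy_balance hν hΔt (hsol.momentum j n hn hnN _ haX) hskew hfluct hpres
    (real_inner_self_eq_norm_sq _) hbdf
    (mul_abs_bStar_le hK hh hCinv hν hΔt hC (v := u j (n + 1)) (hinv w hwX) hfl)
    (mul_apply_le hd hΩb hν hΔt (f j (n + 1)) _)

/-- Summation of a one-step energy estimate. -/
theorem add_sum_le_of_step {E W G R : ℕ → ℝ} {α β : ℝ} {N : ℕ} (hN : 2 < N)
    (h : ∀ n, 2 ≤ n → n < N → E (n + 1) + α * W n + β * G n ≤ E n + R n) :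
    E N + α * ∑ n ∈ Finset.Icc 2 (N - 1), W n + β * ∑ n ∈ Finset.Icc 2 (N - 1), G n ≤
      ∑ n ∈ Finset.Icc 2 (N - 1), R n + E 2 := by
  have key : ∀ k, k + 2 ≤ N →
      E (k + 2) + α * ∑ n ∈ Finset.Icc 2 (k + 1), W n + β * ∑ n ∈ Finset.Icc 2 (k + 1), G n ≤
        ∑ n ∈ Finset.Icc 2 (k + 1), R n + E 2 := by
    intro k
    induction k with
    -- The index is shifted by 2: at `k = 0` the sums over `Icc 2 1` are empty and both sides are `E
    -- 2`.
    | zero => simp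
    | succ k ih =>
      intro hk
      have hk2 : 2 ≤ k + 1 + 1 := by omega
      simp only [Finset.sum_Icc_succ_top hk2]
      have h1 := h (k + 2) (by omega) (by omega)
      have h2 := ih (by omega)
      rw [show k + 1 + 2 = k + 2 + 1 by omega, show k + 1 + 1 = k + 2 by omega]
      linarith
  have h3 := key (N - 2) (by omega)
  rwa [show N - 2 + 2 = N by omega, show N - 2 + 1 = N - 1 by omega] at h3

theorem add_le_add_of_grouped {a b c s t r x y z : ℝ} (h : a + b + c + s + t ≤ r + (x + y + z)) :
    a + b + c + s + t ≤ r + x + y + z := by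
  linarith

theorem exists_stability_const {d : ℕ} (hd : d = 2 ∨ d = 3) {Ω : Set (Vec d)}
    (hΩb : Bornology.IsBounded Ω) {Cinv : ℝ} (hCinv : 0 < Cinv) :
    ∃ (K : ℝ≥0) (C : ℝ), 0 < C ∧
      (∀ v : H10 Ω, eLpNorm (vel v) 6 (volume.restrict Ω) ≤ K * ‖grad v‖ₑ) ∧
      24 * (3 / 2 * d ^ 2 * (K * √K)) ^ 2 * Cinv ≤ C := by
  obtain ⟨K, hK⟩ := exists_eLpNorm_vel_six_le hd hΩb
  -- The added 1 keeps `C` positive even if `K = 0`.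
  exact ⟨K, 24 * (3 / 2 * d ^ 2 * (K * √K)) ^ 2 * Cinv + 1, by positivity, hK, by linarith⟩

end EnBlended

end

theorem theorem1 {d : ℕ} (hd : d = 2 ∨ d = 3) (Ω : Set (EnBlended.Vec d)) (hΩ : IsOpen Ω)
    (hΩb : Bornology.IsBounded Ω) (Cinv : ℝ) (hCinv : 0 < Cinv) :
    ∃ C : ℝ, 0 < C ∧
      ∀ (h : ℝ) (_ : 0 < h)
        (Xh : Submodule ℝ (EnBlended.H10 Ω)) (_ : FiniteDimensional ℝ Xh)
        (Qh : Submodule ℝ (EnBlended.L2 Ω ℝ)) (_ : FiniteDimensional ℝ Qh)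
        (_ : (Qh : Set (EnBlended.L2 Ω ℝ)) ⊆ EnBlended.L20 Ω)
        (_ : ∀ v ∈ Xh, h * ‖EnBlended.grad v‖ ≤ Cinv * ‖EnBlended.vel v‖)
        (ν Δt : ℝ) (_ : 0 < ν) (_ : 0 < Δt) (J NT : ℕ)
        (f : Fin J → ℕ → (EnBlended.H10 Ω →L[ℝ] ℝ))
        (u : Fin J → ℕ → EnBlended.H10 Ω) (p : Fin J → ℕ → EnBlended.L2 Ω ℝ)
        (_ : EnBlended.IsSchemeSolution Xh Qh ν Δt f NT u p)
        (_ : ∀ j n, 2 ≤ n → n < NT →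
          C * (Δt / (ν * h)) * ‖EnBlended.grad (EnBlended.fluct u j n)‖ ^ 2 ≤ 1)
        (j : Fin J) (N : ℕ) (_ : 2 < N) (_ : N ≤ NT),
        1 / 12 * ‖EnBlended.vel (u j N)‖ ^ 2
          + 1 / 12 * ‖EnBlended.vel ((3 : ℝ) • u j N - u j (N - 1))‖ ^ 2
          + 1 / 12 * ‖EnBlended.vel
              ((3 : ℝ) • u j N - (3 : ℝ) • u j (N - 1) + u j (N - 2))‖ ^ 2
          + 1 / 24 * (∑ n ∈ Finset.Icc 2 (N - 1), ‖EnBlended.vel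
              (u j (n + 1) - (3 : ℝ) • u j n + (3 : ℝ) • u j (n - 1) - u j (n - 2))‖ ^ 2)
          + Δt / 4 * (∑ n ∈ Finset.Icc 2 (N - 1), ν * ‖EnBlended.grad (u j (n + 1))‖ ^ 2)
        ≤ (∑ n ∈ Finset.Icc 2 (N - 1), Δt / ν * EnBlended.negNorm (f j (n + 1)) ^ 2)
          + 1 / 12 * ‖EnBlended.vel (u j 2)‖ ^ 2
          + 1 / 12 * ‖EnBlended.vel ((3 : ℝ) • u j 2 - u j 1)‖ ^ 2
          + 1 / 12 * ‖EnBlended.vel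
              ((3 : ℝ) • u j 2 - (3 : ℝ) • u j 1 + u j 0)‖ ^ 2 := by
  have hC := EnBlended.exists_stability_const hd hΩb hCinv
  refine ⟨hC.choose_spec.choose, hC.choose_spec.choose_spec.1, ?_⟩
  intro h hh Xh _ Qh _ _ hinv ν Δt hν hΔt J NT f u p hsol hfl j N hN hNT
  exact EnBlended.add_le_add_of_grouped (EnBlended.add_sum_le_of_step hN fun n hn hnN =>
    EnBlended.energy_succ_le hd hΩb hC.choose_spec.choose_spec.2.1 hh hCinv hν hΔt
      hC.choose_spec.choose_spec.2.2 hinv hsol hn (hnN.trans_le hNT) (hfl j n hn (hnN.trans_le hNT)))
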